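/- Let $\mathcal C$ be a complete, cocomplete, well-powered and locally distributive category in which strong epimorphisms are stable under pullback. (Locally distributive: every slice $\mathcal C/X$ has finite products and finite coproducts, and product with a fixed object of the slice preserves finite coproducts.) **Graphs and relations.** A graph on $X$ is a pair $\mathsf{outl},\mathsf{outr}\colon R\to X$, written $(X,R)$; it is a relation if $\langle\mathsf{outl},\mathsf{outr}\rangle$ is monic. A morphism $(X,R)\to(Y,S)$ is a pair $h_0\colon X\to Y$, $h_1\colon R\to S$ commuting with the projections. For graphs on the same object, $(X,R)\le(X,R')$ means that there is a morphism with $h_0=\mathrm{id}_X$. Let $\mathbf{Rel}(\mathcal C)$ be the category of relations and $\mathbf{Rel}_X(\mathcal C)$ the preorder of relations on $X$. $(-)^\dagger$ turns a graph into a relation by the (strong epi, mono)-factorization of $\langle\mathsf{outl},\mathsf{outr}\rangle$. The composite $R\bullet R'$ of relations on $X$ is the $(-)^\dagger$ of the graph composite, formed by pulling back $\mathsf{outr}_R$ and $\mathsf{outl}_{R'}$. $\vee$ denotes coproducts in $\mathbf{Rel}(\mathcal C)$, or in $\mathbf{Rel}_X(\mathcal C)$ for two relations on the same $X$ where so indicated;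 both are the $(-)^\dagger$ of coproducts of graphs. $(X,X)$ is the identity relation, $R$ is reflexive if $(X,X)\le R$ and transitive if $R\bullet R\le R$. For $f\colon X\to Y$ put $f_\star(X,R)=(Y,R,f\,\mathsf{outl},f\,\mathsf{outr})$. The canonical lifting of an endofunctor $F$ is $\bar F(X,R)=(FX,FR,F\mathsf{outl},F\mathsf{outr})^\dagger$. **Data.** Let $\Sigma=V+\Sigma'\colon\mathcal C\to\mathcal C$, for an object $V$ and an endofunctor $\Sigma'$, preserve strong epimorphisms and have free algebras on all objects, with free monad $\Sigma^\star$ and initial algebra $\iota\colon\Sigma(\mu\Sigma)\to\mu\Sigma$; every $\Sigma$-algebra $(A,a)$ is $V$-pointed by $a\circ\mathsf{inl}$, and $\hat a\colon\Sigma^\star A\to A$ is the free extension of $\mathrm{id}_A$. Let $B\colon\mathcal C^{\mathrm{op}}\times\mathcal C\to\mathcal C$ be a functor with, for all $X,Y,Z$, a preorder $\preceq$ on $\mathcal C(Z,B(X,Y))$ that is stable under precomposition. Let $\bar B\colon\mathbf{Rel}(\mathcal C)^{\mathrm{op}}\times\mathbf{Rel}(\mathcal C)\to\mathbf{Rel}(\mathcal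 C)$ be a functor lying over $B$ that is good for simulations, i.e. for all $X$, $Y$ and all relations $(X,R)$, $(Y,S)$, $(Y,S')$: 1. writing $\bar B((X,R),(Y,S))=(B(X,Y),E)$: if $(G,\mathsf{outl}_G,\mathsf{outr}_G)$ is a graph on $B(X,Y)$ and some $h\colon G\to E$ satisfies $\mathsf{outl}_E\,h=\mathsf{outl}_G$ and $\mathsf{outr}_E\,h\preceq\mathsf{outr}_G$, then $(B(X,Y),G)\le(B(X,Y),E)$; 2. $\bar B((X,X),(Y,Y))$ is reflexive; 3. $\bar B((X,R),(Y,S))\bullet\bar B((X,X),(Y,S'))\le\bar B((X,R),(Y,S)\bullet(Y,S'))$. Let $\rho_{X,Y}\colon\Sigma(X\times B(X,Y))\to B(X,\Sigma^\star(X+Y))$ be a $V$-pointed higher-order GSOS law, i.e. a family of morphisms dinatural in $X\in V/\mathcal C$ and natural in $Y\in\mathcal C$. Assume that $\rho$ admits a relation lifting, i.e. for all relations $(X,R)$, $(Y,S)$ and every morphism of relations $(V,V)\to(X,R)$ (by whose $0$-component $X$ is $V$-pointed), $\rho_{X,Y}$ is a morphism of relations $\bar\Sigma\big((X,R)\times\bar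 B((X,R),(Y,S))\big)\to\bar B\big((X,R),\overline{\Sigma^\star}((X,R)\vee(Y,S))\big)$. The operational model of $\rho$ is the unique $\gamma\colon\mu\Sigma\to B(\mu\Sigma,\mu\Sigma)$ with $\gamma\circ\iota=B(\mathrm{id},\hat\iota)\circ B(\mathrm{id},\Sigma^\star\nabla)\circ\rho_{\mu\Sigma,\mu\Sigma}\circ\Sigma\langle\mathrm{id},\gamma\rangle$. **Weak simulations.** For $\tilde\gamma\colon\mu\Sigma\to B(\mu\Sigma,\mu\Sigma)$ and a relation $(\mu\Sigma,R)$ write $\bar B((\mu\Sigma,\mu\Sigma),(\mu\Sigma,R))=(B(\mu\Sigma,\mu\Sigma),E_R)$ and consider the conditions: (a) some $k\colon R\to E_R$ satisfies $\mathsf{outl}_{E_R}k=\tilde\gamma\,\mathsf{outl}_R$ and $\mathsf{outr}_{E_R}k=\tilde\gamma\,\mathsf{outr}_R$; (b) some $k\colon R\to E_R$ satisfies $\mathsf{outl}_{E_R}k=\gamma\,\mathsf{outl}_R$ and $\mathsf{outr}_{E_R}k=\tilde\gamma\,\mathsf{outr}_R$. Then $\tilde\gamma$ is a weakening of $\gamma$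 if (a) and (b) are equivalent for every relation $R$ on $\mu\Sigma$, and in that case $R$ is a weak simulation on $(\mu\Sigma,\gamma)$ if (b) holds. **Proposition.** Let $\tilde\gamma$ be a weakening of $\gamma$ such that $(\mu\Sigma,\iota,\tilde\gamma)$ is a lax $\rho$-bialgebra, i.e. $B(\mathrm{id},\hat\iota)\circ B(\mathrm{id},\Sigma^\star\nabla)\circ\rho_{\mu\Sigma,\mu\Sigma}\circ\Sigma\langle\mathrm{id},\tilde\gamma\rangle\preceq\tilde\gamma\circ\iota$. Then for every reflexive and transitive weak simulation $R$ on $(\mu\Sigma,\gamma)$, the Howe closure $\hat R$, defined as the initial algebra of the monotone map $S\mapsto R\vee\big((\iota_\star\bar\Sigma S)\bullet R\big)$ on $\mathbf{Rel}_{\mu\Sigma}(\mathcal C)$ (with $\vee$ formed in $\mathbf{Rel}_{\mu\Sigma}(\mathcal C)$), is again a weak simulation on $(\mu\Sigma,\gamma)$. -/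

import Mathlib

open CategoryTheory CategoryTheory.Limits Opposite

universe v u

namespace HOGSOS

noncomputable section

/-! ### The base category -/

/-- A distributive category: finite products and coproducts exist, and each functor
`X ⨯ (-)` preserves finite coproducts (including the initial object). -/
class Distributive (D : Type u) [Category.{v} D] : Prop where
  finiteProducts : HasFiniteProducts D
  finiteCoproducts : HasFiniteCoproducts D
  preserves : ∀ X : D, PreservesFiniteCoproducts (prod.functor.obj X)

/-- A locally distributive category: every slice is distributive. -/
def LocallyDistributive (C : Type u) [Category.{v} C] : Prop :=
  ∀ X : C, Distributive (Over X)

/-- Strong epimorphisms are stable under pullback. -/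
def StrongEpisPullbackStable (C : Type u) [Category.{v} C] : Prop :=
  ∀ ⦃P A B D : C⦄ ⦃e' : P ⟶ A⦄ ⦃f' : P ⟶ B⦄ ⦃f : A ⟶ D⦄ ⦃e : B ⟶ D⦄,
    IsPullback e' f' f e → StrongEpi e → StrongEpi e'

/-- In a complete and well-powered category every morphism has an image, namely the intersection
of all subobjects through which it factors. By
`hasStrongEpiImages_of_hasPullbacks_of_hasEqualizers` the factorization of `f` through `image f`
is the (strong epi, mono)-factorization of `f`. -/
instance hasImages_of_wellPowered (C : Type u) [Category.{v} C] [HasLimits C]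
    [WellPowered.{v} C] : HasImages C where
  has_image {X Y} f := by
    let T : Subobject Y := Subobject.sInf.{v} {S : Subobject Y | S.Factors f}
    have hfac : T.Factors f := by
      have h : ∀ {S : Set (Subobject Y)}, (∀ s ∈ S, s.Factors f) →
          ∃ g, g ≫ Subobject.widePullbackι.{v} S = f := by
        intro S hS
        refine ⟨WidePullback.lift f (fun j => ((equivShrink.{v} (Subobject Y)).symm
          (j : Shrink.{v} (Subobject Y))).factorThru f ?_) ?_, ?_⟩
        · obtain ⟨j, s, hs, rfl⟩ := j
          simpa using hS s hs
        · intro j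
          exact Subobject.factorThru_arrow _ _ _
        · exact WidePullback.lift_base _ _ _ _
      obtain ⟨g, hg⟩ := h (S := {S : Subobject Y | S.Factors f}) (fun s hs => hs)
      exact (Subobject.mk_factors_iff _ _).2 ⟨g, hg⟩
    exact HasImage.mk
      { F := { I := (T : C)
               m := T.arrow
               e := Subobject.factorThru T f hfac
               fac := Subobject.factorThru_arrow _ _ _ }
        isImage :=
          { lift := fun F' => Subobject.ofLE T (Subobject.mk F'.m)
              (Subobject.sInf_le.{v} _ _ ((Subobject.mk_factors_iff _ _).2 ⟨F'.e, F'.fac⟩)) ≫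
                (Subobject.underlyingIso F'.m).hom
            lift_fac := fun F' => by simp } }

/-! ### Graphs and relations -/

/-- A graph `(X, E, outl, outr)` on the object `X`. -/
structure Graph {C : Type u} [Category.{v} C] (X : C) where
  E : C
  outl : E ⟶ X
  outr : E ⟶ X

namespace Graph

variable {C : Type u} [Category.{v} C]

/-- The morphism `f : X ⟶ Y` is the base component of a graph morphism `(f, h)` from the graph
`G` on `X` to the graph `H` on `Y`. If `H` is a relation then `h` is unique, so this says that
`f` is a morphism of relations. -/
def IsHom {X Y : C} (f : X ⟶ Y) (G : Graph X) (H : Graph Y) : Prop :=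
  ∃ h : G.E ⟶ H.E, h ≫ H.outl = G.outl ≫ f ∧ h ≫ H.outr = G.outr ≫ f

/-- Existence of a morphism of graphs over the identity of `X`. -/
def Le {X : C} (G H : Graph X) : Prop :=
  ∃ h : G.E ⟶ H.E, h ≫ H.outl = G.outl ∧ h ≫ H.outr = G.outr

/-- The identity graph `(X, X, id, id)`. -/
abbrev idGraph (X : C) : Graph X := ⟨X, 𝟙 X, 𝟙 X⟩

/-- Pushing a graph forward along a morphism of base objects. -/
abbrev push {X Y : C} (f : X ⟶ Y) (G : Graph X) : Graph Y := ⟨G.E, G.outl ≫ f, G.outr ≫ f⟩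

/-- Applying a functor to a graph: the canonical graph lifting of the functor. -/
abbrev mapFunctor (F : C ⥤ C) {X : C} (G : Graph X) : Graph (F.obj X) :=
  ⟨F.obj G.E, F.map G.outl, F.map G.outr⟩

/-- The composite of two graphs on `X`. -/
abbrev comp [HasPullbacks C] {X : C} (G H : Graph X) : Graph X :=
  ⟨pullback G.outr H.outl, pullback.fst G.outr H.outl ≫ G.outl,
    pullback.snd G.outr H.outl ≫ H.outr⟩

/-- The coproduct of two graphs on the same object `X`, over `X`. -/
abbrev sumOver [HasBinaryCoproducts C] {X : C} (G H : Graph X) : Graph X :=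
  ⟨G.E ⨿ H.E, coprod.desc G.outl H.outl, coprod.desc G.outr H.outr⟩

/-- The coproduct of a graph on `X` and a graph on `Y`, a graph on `X ⨿ Y`. -/
abbrev sum [HasBinaryCoproducts C] {X Y : C} (G : Graph X) (H : Graph Y) : Graph (X ⨿ Y) :=
  ⟨G.E ⨿ H.E, coprod.map G.outl H.outl, coprod.map G.outr H.outr⟩

/-- The product of a graph on `X` and a graph on `Y`, a graph on `X ⨯ Y`. -/
abbrev prod [HasBinaryProducts C] {X Y : C} (G : Graph X) (H : Graph Y) : Graph (X ⨯ Y) :=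
  ⟨G.E ⨯ H.E, Limits.prod.map G.outl H.outl, Limits.prod.map G.outr H.outr⟩

/-- The pairing `⟨outl, outr⟩ : E ⟶ X ⨯ X`. -/
def pair [HasBinaryProducts C] {X : C} (G : Graph X) : G.E ⟶ X ⨯ X :=
  prod.lift G.outl G.outr

@[simp]
theorem pair_fst [HasBinaryProducts C] {X : C} (G : Graph X) :
    G.pair ≫ Limits.prod.fst = G.outl := prod.lift_fst _ _

@[simp]
theorem pair_snd [HasBinaryProducts C] {X : C} (G : Graph X) :
    G.pair ≫ Limits.prod.snd = G.outr := prod.lift_snd _ _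

@[simp]
theorem pair_fst_assoc [HasBinaryProducts C] {X Z : C} (G : Graph X) (f : X ⟶ Z) :
    G.pair ≫ Limits.prod.fst ≫ f = G.outl ≫ f := by rw [← Category.assoc, pair_fst]

@[simp]
theorem pair_snd_assoc [HasBinaryProducts C] {X Z : C} (G : Graph X) (f : X ⟶ Z) :
    G.pair ≫ Limits.prod.snd ≫ f = G.outr ≫ f := by rw [← Category.assoc, pair_snd]

theorem Le.trans {X : C} {G H K : Graph X} : G.Le H → H.Le K → G.Le K := by
  rintro ⟨h, h₁, h₂⟩ ⟨k, k₁, k₂⟩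
  exact ⟨h ≫ k, by simp [*], by simp [*]⟩

end Graph

/-- A relation on `X`: a graph whose projections are jointly monic. -/
structure Relation {C : Type u} [Category.{v} C] [HasBinaryProducts C] (X : C)
    extends Graph X where
  mono_pair : Mono toGraph.pair

namespace Relation

section

variable {C : Type u} [Category.{v} C] [HasBinaryProducts C]

/-- The order on relations on `X`: existence of a graph morphism over the identity of `X`. -/
instance (X : C) : Preorder (Relation X) where
  le R S := Graph.Le R.toGraph S.toGraph
  le_refl R := ⟨𝟙 _, by simp, by simp⟩
  le_trans R S T := Graph.Le.trans

theorem le_def {X : C} {R S : Relation X} : R ≤ S ↔ Graph.Le R.toGraph S.toGraph := Iff.rfl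

/-- The identity relation `(X, X)`. -/
abbrev idRel (X : C) : Relation X where
  toGraph := Graph.idGraph X
  mono_pair := ⟨fun a b h => by
    have := congrArg (· ≫ Limits.prod.fst) h
    simpa using this⟩

/-- The product of relations `(X, R) × (Y, S)`. -/
abbrev prod {X Y : C} (R : Relation X) (S : Relation Y) : Relation (X ⨯ Y) where
  toGraph := R.toGraph.prod S.toGraph
  mono_pair := ⟨fun {Z} a b h => by
    have := R.mono_pair
    have := S.mono_pair
    have hl := congrArg (· ≫ Limits.prod.fst) h
    have hr := congrArg (· ≫ Limits.prod.snd) h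
    simp only [Category.assoc, Graph.pair_fst, Graph.pair_snd] at hl hr
    have hl₁ := congrArg (· ≫ Limits.prod.fst) hl
    have hl₂ := congrArg (· ≫ Limits.prod.snd) hl
    have hr₁ := congrArg (· ≫ Limits.prod.fst) hr
    have hr₂ := congrArg (· ≫ Limits.prod.snd) hr
    simp only [Category.assoc, prod.map_fst, prod.map_snd] at hl₁ hl₂ hr₁ hr₂
    apply Limits.prod.hom_ext
    · rw [← cancel_mono R.toGraph.pair]
      apply Limits.prod.hom_ext <;> simpa
    · rw [← cancel_mono S.toGraph.pair]
      apply Limits.prod.hom_ext <;> simpa⟩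

/-- Pushing a relation forward along a monomorphism of base objects. -/
abbrev push {X Y : C} (f : X ⟶ Y) (hf : Mono f) (R : Relation X) : Relation Y where
  toGraph := R.toGraph.push f
  mono_pair := by
    have := R.mono_pair
    have h : (R.toGraph.push f).pair = R.toGraph.pair ≫ Limits.prod.map f f := by
      apply Limits.prod.hom_ext <;> simp
    rw [h]
    exact mono_comp R.toGraph.pair _

theorem push_mono {X Y : C} (f : X ⟶ Y) (hf : Mono f) : Monotone (push f hf) := by
  rintro R S ⟨h, h₁, h₂⟩
  exact ⟨h, by simp only [push, Graph.push, ← Category.assoc, h₁],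
    by simp only [push, Graph.push, ← Category.assoc, h₂]⟩

end

section

variable {C : Type u} [Category.{v} C] [HasLimits C] [WellPowered.{v} C]

/-- The relation generated by a graph, obtained from the (strong epi, mono)-factorization of
`⟨outl, outr⟩ : E ⟶ X ⨯ X`. -/
def dag {X : C} (G : Graph X) : Relation X where
  toGraph := ⟨image G.pair, image.ι G.pair ≫ Limits.prod.fst, image.ι G.pair ≫ Limits.prod.snd⟩
  mono_pair := by
    have h : Graph.pair ⟨image G.pair, image.ι G.pair ≫ Limits.prod.fst,
        image.ι G.pair ≫ Limits.prod.snd⟩ = image.ι G.pair := by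
      apply Limits.prod.hom_ext <;> simp
    rw [h]
    infer_instance

theorem le_dag {X : C} (G : Graph X) : G.Le (dag G).toGraph :=
  ⟨factorThruImage G.pair, by simp [dag], by simp [dag]⟩

theorem dag_isHom {X Y : C} {f : X ⟶ Y} {G : Graph X} {S : Relation Y}
    (h : G.IsHom f S.toGraph) : (dag G).toGraph.IsHom f S.toGraph := by
  obtain ⟨k, k₁, k₂⟩ := h
  have := S.mono_pair
  have sq : CommSq k (factorThruImage G.pair) S.toGraph.pair
      (image.ι G.pair ≫ Limits.prod.map f f) := by
    constructor
    rw [image.fac_assoc]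
    apply Limits.prod.hom_ext <;> simp [*]
  refine ⟨sq.lift, ?_, ?_⟩
  · change sq.lift ≫ S.outl = (image.ι G.pair ≫ Limits.prod.fst) ≫ f
    rw [← Graph.pair_fst, ← Category.assoc, sq.fac_right]
    simp
  · change sq.lift ≫ S.outr = (image.ι G.pair ≫ Limits.prod.snd) ≫ f
    rw [← Graph.pair_snd, ← Category.assoc, sq.fac_right]
    simp

theorem dag_le {X : C} {G : Graph X} {S : Relation X}
    (h : G.Le S.toGraph) : dag G ≤ S := by
  obtain ⟨k, k₁, k₂⟩ := h
  obtain ⟨l, l₁, l₂⟩ := dag_isHom (f := 𝟙 X) (G := G) (S := S) ⟨k, by simpa, by simpa⟩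
  exact ⟨l, by simpa using l₁, by simpa using l₂⟩

theorem dag_mono {X : C} {G H : Graph X} (h : G.Le H) : dag G ≤ dag H :=
  dag_le (h.trans (le_dag H))

/-- Composition of relations on `X`. -/
def comp {X : C} (R S : Relation X) : Relation X := dag (R.toGraph.comp S.toGraph)

theorem comp_mono {X : C} {R R' S S' : Relation X} (h : R ≤ R') (k : S ≤ S') :
    R.comp S ≤ R'.comp S' := by
  obtain ⟨h, h₁, h₂⟩ := h
  obtain ⟨k, k₁, k₂⟩ := k
  refine dag_mono ⟨pullback.lift (pullback.fst R.outr S.outl ≫ h)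
    (pullback.snd R.outr S.outl ≫ k) ?_, ?_, ?_⟩
  · simp [h₂, k₁, pullback.condition]
  · simp [pullback.lift_fst_assoc, h₁]
  · simp [pullback.lift_snd_assoc, k₂]

/-- `(X, R)` is reflexive if it contains the identity relation. -/
def IsReflexive {X : C} (R : Relation X) : Prop := idRel X ≤ R

/-- `(X, R)` is transitive if `R • R ≤ R`. -/
def IsTransitive {X : C} (R : Relation X) : Prop := R.comp R ≤ R

variable [HasBinaryCoproducts C]

/-- The coproduct `(X, R) ∨ (Y, S)`, a relation on `X ⨿ Y`. -/
def sum {X Y : C} (R : Relation X) (S : Relation Y) : Relation (X ⨿ Y) :=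
  dag (R.toGraph.sum S.toGraph)

/-- The coproduct (join) of two relations on the same object `X`. -/
def join {X : C} (R S : Relation X) : Relation X := dag (R.toGraph.sumOver S.toGraph)

theorem join_mono {X : C} {R R' S S' : Relation X} (h : R ≤ R') (k : S ≤ S') :
    R.join S ≤ R'.join S' := by
  obtain ⟨h, h₁, h₂⟩ := h
  obtain ⟨k, k₁, k₂⟩ := k
  refine dag_mono ⟨coprod.map h k, ?_, ?_⟩
  · ext <;> simp [h₁, k₁]
  · ext <;> simp [h₂, k₂]

end

end Relation

/-! ### Preorders -/

/-- A preordered object: a preorder on each hom-set `Y ⟶ X`, stable under precomposition. -/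
structure PreorderOn {C : Type u} [Category.{v} C] (X : C) where
  le : ∀ {Y : C}, (Y ⟶ X) → (Y ⟶ X) → Prop
  refl : ∀ {Y : C} (f : Y ⟶ X), le f f
  trans : ∀ {Y : C} (f g h : Y ⟶ X), le f g → le g h → le f h
  precomp : ∀ {Y Z : C} (h : Z ⟶ Y) (f g : Y ⟶ X), le f g → le (h ≫ f) (h ≫ g)

/-- Existence of a right-lax morphism over the identity of the preordered object `(X, P)`. -/
def RightLaxLe {C : Type u} [Category.{v} C] {X : C} (P : PreorderOn X) (G H : Graph X) : Prop :=
  ∃ h : G.E ⟶ H.E, h ≫ H.outl = G.outl ∧ P.le (h ≫ H.outr) G.outr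

/-- A relation on a preordered object is good for simulations if every graph with a right-lax
morphism into it has a strict morphism into it. -/
def GoodForSimulations {C : Type u} [Category.{v} C] [HasBinaryProducts C] {X : C}
    (P : PreorderOn X) (S : Relation X) : Prop :=
  ∀ G : Graph X, RightLaxLe P G S.toGraph → G.Le S.toGraph

/-! ### Relation liftings of functors -/

/-- A relation lifting of an endofunctor `F`, i.e. a functor on the category of relations lying
strictly over `F`. A morphism of relations is determined by its base component, so such a functor
is an assignment of relations `rel R` on `F X` to relations `R` on `X` such that `F f` is a
morphism of relations whenever `f` is. -/
structure RelLifting {C : Type u} [Category.{v} C] [HasBinaryProducts C] (F : C ⥤ C) where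
  rel : ∀ {X : C}, Relation X → Relation (F.obj X)
  isHom_map : ∀ {X Y : C} (f : X ⟶ Y) (R : Relation X) (S : Relation Y),
    R.toGraph.IsHom f S.toGraph → (rel R).toGraph.IsHom (F.map f) (rel S).toGraph

/-- A relation lifting of a mixed-variance bifunctor `B`, i.e. a functor
`Relᵒᵖ × Rel ⥤ Rel` lying strictly over `B`, given as in `RelLifting` by its action on objects
and the lifting property on morphisms. -/
structure BiRelLifting {C : Type u} [Category.{v} C] [HasBinaryProducts C]
    (B : Cᵒᵖ ⥤ C ⥤ C) where
  rel : ∀ {X Y : C}, Relation X → Relation Y → Relation ((B.obj (op X)).obj Y)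
  isHom_map : ∀ {X X' Y Y' : C} (f : X' ⟶ X) (g : Y ⟶ Y') (R : Relation X) (R' : Relation X')
    (S : Relation Y) (S' : Relation Y'),
    R'.toGraph.IsHom f R.toGraph → S.toGraph.IsHom g S'.toGraph →
      (rel R S).toGraph.IsHom ((B.map f.op).app Y ≫ (B.obj (op X')).map g) (rel R' S').toGraph

/-- The relation lifting `B̄((X, R), -)` of the endofunctor `B(X, -)`. -/
def BiRelLifting.at {C : Type u} [Category.{v} C] [HasBinaryProducts C]
    {B : Cᵒᵖ ⥤ C ⥤ C} (L : BiRelLifting B) {X : C} (R : Relation X) :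
    RelLifting (B.obj (op X)) where
  rel S := L.rel R S
  isHom_map f S S' h := by
    have := L.isHom_map (𝟙 X) f R R S S' ⟨𝟙 _, by simp, by simp⟩ h
    simpa using this

section

variable {C : Type u} [Category.{v} C] [HasLimits C] [WellPowered.{v} C]

/-- The canonical relation lifting of an endofunctor. -/
def canonicalLifting (F : C ⥤ C) : RelLifting F where
  rel R := Relation.dag (R.toGraph.mapFunctor F)
  isHom_map f R S := by
    rintro ⟨h, h₁, h₂⟩
    apply Relation.dag_isHom
    obtain ⟨l, l₁, l₂⟩ := Relation.le_dag (S.toGraph.mapFunctor F)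
    refine ⟨F.map h ≫ l, ?_, ?_⟩
    · rw [Category.assoc, l₁]
      simp only [Graph.mapFunctor, ← F.map_comp, h₁]
    · rw [Category.assoc, l₂]
      simp only [Graph.mapFunctor, ← F.map_comp, h₂]

theorem canonicalLifting_mono (F : C ⥤ C) {X : C} :
    Monotone (fun R : Relation X => (canonicalLifting F).rel R) := by
  rintro R S ⟨h, h₁, h₂⟩
  obtain ⟨l, l₁, l₂⟩ := (canonicalLifting F).isHom_map (𝟙 X) R S ⟨h, by simpa, by simpa⟩
  exact ⟨l, by simpa using l₁, by simpa using l₂⟩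

/-- A relation lifting of a preordered bifunctor is good for simulations. -/
structure BiRelLifting.IsGoodForSimulations {B : Cᵒᵖ ⥤ C ⥤ C} (L : BiRelLifting B)
    (P : ∀ X Y : C, PreorderOn ((B.obj (op X)).obj Y)) : Prop where
  good : ∀ {X Y : C} (R : Relation X) (S : Relation Y), GoodForSimulations (P X Y) (L.rel R S)
  reflexive : ∀ X Y : C, (L.rel (Relation.idRel X) (Relation.idRel Y)).IsReflexive
  comp_le : ∀ {X Y : C} (R : Relation X) (S S' : Relation Y),
    (L.rel R S).comp (L.rel (Relation.idRel X) S') ≤ L.rel R (S.comp S')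

/-! ### Howe closures -/

variable [HasBinaryCoproducts C]

/-- The monotone map `S ↦ R ∨ ((ξ⋆ Σ̄ S) • R)` on relations on the carrier of a monic algebra
`ξ : Σ X ⟶ X`, as an endofunctor of the thin category of relations on `X`. -/
def howeFunctor (F : C ⥤ C) {X : C} (ξ : F.obj X ⟶ X) (hξ : Mono ξ) (R : Relation X) :
    Relation X ⥤ Relation X :=
  Monotone.functor
    (f := fun S => R.join ((((canonicalLifting F).rel S).push ξ hξ).comp R))
    (fun _ _ h => Relation.join_mono le_rfl
      (Relation.comp_mono (Relation.push_mono ξ hξ (canonicalLifting_mono F h)) le_rfl))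

/-- The monotone map defining the Howe closure has an initial algebra, namely the intersection
of all its pre-fixed points. -/
theorem hasInitial_howe (F : C ⥤ C) {X : C} (ξ : F.obj X ⟶ X) (hξ : Mono ξ) (R : Relation X) :
    HasInitial (Endofunctor.Algebra (howeFunctor F ξ hξ R)) := by
  let sub : Relation X → Subobject (X ⨯ X) := fun S =>
    haveI := S.mono_pair
    Subobject.mk S.toGraph.pair
  have sub_le : ∀ S T : Relation X, sub S ≤ sub T ↔ S ≤ T := by
    intro S T
    have := S.mono_pair
    have := T.mono_pair
    constructor
    · intro h
      have h' := Subobject.ofMkLEMk_comp (f := S.toGraph.pair) (g := T.toGraph.pair) h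
      refine ⟨Subobject.ofMkLEMk S.toGraph.pair T.toGraph.pair h, ?_, ?_⟩
      · rw [← Graph.pair_fst, ← Category.assoc, h', Graph.pair_fst]
      · rw [← Graph.pair_snd, ← Category.assoc, h', Graph.pair_snd]
    · rintro ⟨h, h₁, h₂⟩
      refine Subobject.mk_le_mk_of_comm h ?_
      apply Limits.prod.hom_ext <;> simp [*]
  have sub_surj : ∀ P : Subobject (X ⨯ X), ∃ S : Relation X, sub S = P := by
    intro P
    have hp : Graph.pair ⟨(P : C), P.arrow ≫ Limits.prod.fst, P.arrow ≫ Limits.prod.snd⟩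
        = P.arrow := by
      apply Limits.prod.hom_ext <;> simp
    refine ⟨⟨⟨(P : C), P.arrow ≫ Limits.prod.fst, P.arrow ≫ Limits.prod.snd⟩, ?_⟩, ?_⟩
    · rw [hp]; infer_instance
    · simp only [sub, hp, Subobject.mk_arrow]
  obtain ⟨S, hS⟩ := sub_surj
    (Subobject.sInf.{v} {P | ∃ T : Relation X, (howeFunctor F ξ hξ R).obj T ≤ T ∧ sub T = P})
  have hle : ∀ T : Relation X, (howeFunctor F ξ hξ R).obj T ≤ T → S ≤ T := by
    intro T hT
    rw [← sub_le, hS]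
    exact Subobject.sInf_le.{v} _ _ ⟨T, hT, rfl⟩
  have hfix : (howeFunctor F ξ hξ R).obj S ≤ S := by
    rw [← sub_le, hS]
    refine Subobject.le_sInf.{v} _ _ ?_
    rintro _ ⟨T, hT, rfl⟩
    rw [sub_le]
    exact (leOfHom ((howeFunctor F ξ hξ R).map (homOfLE (hle T hT)))).trans hT
  let A : Endofunctor.Algebra (howeFunctor F ξ hξ R) := ⟨S, homOfLE hfix⟩
  have hA : IsInitial A := IsInitial.ofUniqueHom
    (fun T => ⟨homOfLE (hle T.a (leOfHom T.str)), Subsingleton.elim _ _⟩)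
    (fun T m => by ext; exact Subsingleton.elim _ _)
  exact hA.hasInitial

/-- The Howe closure of `(X, R)` with respect to the monic algebra `ξ : Σ X ⟶ X`: the carrier of
the initial algebra of `howeFunctor`. -/
def howeClosure (F : C ⥤ C) {X : C} (ξ : F.obj X ⟶ X) (hξ : Mono ξ) (R : Relation X) :
    Relation X :=
  haveI := hasInitial_howe F ξ hξ R
  (⊥_ (Endofunctor.Algebra (howeFunctor F ξ hξ R))).a

end

theorem mono_str {C : Type u} [Category.{v} C] {F : C ⥤ C} {A : Endofunctor.Algebra F}
    (hA : IsInitial A) : Mono A.str :=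
  haveI := Endofunctor.Algebra.Initial.str_isIso hA
  inferInstance

/-! ### Simulations -/

section

variable {C : Type u} [Category.{v} C] [HasBinaryProducts C]

/-- A simulation on the coalgebra `c : X ⟶ F X` with respect to a relation lifting of `F`. -/
def IsSimulation {F : C ⥤ C} (L : RelLifting F) {X : C} (c : X ⟶ F.obj X) (R : Relation X) :
    Prop :=
  (R.toGraph.push c).Le (L.rel R).toGraph

/-- The weak simulation square: left transitions of `c` are simulated by transitions of `c'`. -/
def IsWeakSimulation {F : C ⥤ C} (L : RelLifting F) {X : C} (c c' : X ⟶ F.obj X)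
    (R : Relation X) : Prop :=
  ∃ k : R.E ⟶ (L.rel R).E, k ≫ (L.rel R).outl = R.outl ≫ c ∧ k ≫ (L.rel R).outr = R.outr ≫ c'

/-- `c'` is a weakening of `c`. A weak simulation on `(X, c)` with respect to a weakening `c'` is
then a relation with either of the two equivalent properties. -/
def IsWeakening {F : C ⥤ C} (L : RelLifting F) {X : C} (c c' : X ⟶ F.obj X) : Prop :=
  ∀ R : Relation X, IsSimulation L c' R ↔ IsWeakSimulation L c c' R

end

/-! ### Free algebras and primitive recursion -/

/-- A free `F`-algebra on `X`. -/
structure FreeAlg {C : Type u} [Category.{v} C] (F : C ⥤ C) (X : C) where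
  alg : Endofunctor.Algebra F
  unit : X ⟶ alg.a
  ext : ∀ (A : Endofunctor.Algebra F), (X ⟶ A.a) → (alg ⟶ A)
  fac : ∀ (A : Endofunctor.Algebra F) (h : X ⟶ A.a), unit ≫ (ext A h).f = h
  uniq : ∀ (A : Endofunctor.Algebra F) (h : X ⟶ A.a) (g : alg ⟶ A), unit ≫ g.f = h → g = ext A h

section

variable {C : Type u} [Category.{v} C] {F : C ⥤ C}

/-- The underlying functor `F⋆` of the free monad generated by `F`. -/
def freeFunctor (free : ∀ X : C, FreeAlg F X) : C ⥤ C where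
  obj X := (free X).alg.a
  map {X Y} f := ((free X).ext (free Y).alg (f ≫ (free Y).unit)).f
  map_id X := by
    rw [← (free X).uniq (free X).alg (𝟙 X ≫ (free X).unit) (𝟙 _) (by simp)]
    rfl
  map_comp {X Y Z} f g := by
    rw [← Endofunctor.Algebra.comp_f, ← (free X).uniq (free Z).alg _
      ((free X).ext (free Y).alg (f ≫ (free Y).unit) ≫
        (free Y).ext (free Z).alg (g ≫ (free Z).unit))]
    rw [Endofunctor.Algebra.comp_f, ← Category.assoc, (free X).fac, Category.assoc,
      (free Y).fac, Category.assoc]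

/-- The Eilenberg-Moore structure `â : F⋆ A ⟶ A` of an `F`-algebra `(A, a)`. -/
def evalHat (free : ∀ X : C, FreeAlg F X) (A : Endofunctor.Algebra F) :
    (freeFunctor free).obj A.a ⟶ A.a :=
  ((free A.a).ext A (𝟙 A.a)).f

variable [HasBinaryProducts C]

/-- The algebra structure on `μF ⨯ A` used for primitive recursion. -/
abbrev primRecAlg (M : Endofunctor.Algebra F) {A : C} (a : F.obj (M.a ⨯ A) ⟶ A) :
    Endofunctor.Algebra F :=
  ⟨M.a ⨯ A, prod.lift (F.map Limits.prod.fst ≫ M.str) a⟩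

/-- Primitive recursion on an initial algebra. -/
def primRec {M : Endofunctor.Algebra F} (hM : IsInitial M) {A : C} (a : F.obj (M.a ⨯ A) ⟶ A) :
    M.a ⟶ A :=
  (hM.to (primRecAlg M a)).f ≫ Limits.prod.snd

/-- `primRec hM a` is the unique morphism making the primitive recursion square commute. -/
theorem primRec_iff {M : Endofunctor.Algebra F} (hM : IsInitial M) {A : C}
    (a : F.obj (M.a ⨯ A) ⟶ A) (h : M.a ⟶ A) :
    M.str ≫ h = F.map (prod.lift (𝟙 _) h) ≫ a ↔ h = primRec hM a := by
  constructor
  · intro hh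
    let g : M ⟶ primRecAlg M a := ⟨prod.lift (𝟙 _) h, by
      apply Limits.prod.hom_ext
      · rw [Category.assoc, Category.assoc, prod.lift_fst, prod.lift_fst, ← Category.assoc,
          ← F.map_comp, prod.lift_fst, F.map_id, Category.id_comp, Category.comp_id]
      · rw [Category.assoc, Category.assoc, prod.lift_snd, prod.lift_snd, hh]⟩
    rw [primRec, hM.hom_ext (hM.to (primRecAlg M a)) g]
    exact (prod.lift_snd _ _).symm
  · rintro rfl
    let p : primRecAlg M a ⟶ M := ⟨Limits.prod.fst, (prod.lift_fst _ _).symm⟩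
    have h₁ : (hM.to (primRecAlg M a)).f ≫ Limits.prod.fst = 𝟙 M.a :=
      congrArg Endofunctor.Algebra.Hom.f (hM.hom_ext (hM.to (primRecAlg M a) ≫ p) (𝟙 M))
    have h₂ : prod.lift (𝟙 M.a) (primRec hM a) = (hM.to (primRecAlg M a)).f := by
      apply Limits.prod.hom_ext
      · rw [prod.lift_fst]
        exact h₁.symm
      · rw [prod.lift_snd]
        rfl
    rw [h₂]
    have h₃ := congrArg (· ≫ Limits.prod.snd) (hM.to (primRecAlg M a)).h
    simp only [Category.assoc, prod.lift_snd] at h₃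
    exact h₃.symm

end

/-! ### Higher-order GSOS laws -/

section

variable {C : Type u} [Category.{v} C] [HasBinaryProducts C] [HasBinaryCoproducts C]

/-- The functor `Σ = V + Σ'`. -/
def sigmaFunctor (V : C) (S' : C ⥤ C) : C ⥤ C where
  obj X := V ⨿ S'.obj X
  map f := coprod.map (𝟙 V) (S'.map f)

/-- A functor preserves strong epimorphisms. -/
def PreservesStrongEpis (F : C ⥤ C) : Prop :=
  ∀ ⦃X Y : C⦄ (e : X ⟶ Y), StrongEpi e → StrongEpi (F.map e)

/-- The point `V ⟶ Σ A ⟶ A` of an algebra for `Σ = V + Σ'`. -/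
def point {V : C} {S' : C ⥤ C} (A : Endofunctor.Algebra (sigmaFunctor V S')) : Under V :=
  Under.mk ((coprod.inl : V ⟶ V ⨿ S'.obj A.a) ≫ A.str)

/-- A `V`-pointed higher-order GSOS law of `Σ = V + Σ'` over `B`: a family of morphisms
`Σ (X × B(X, Y)) ⟶ B(X, Σ⋆ (X + Y))`, dinatural in the `V`-pointed object `X` and natural
in `Y`. -/
structure HOGSOSLaw (V : C) (S' : C ⥤ C) (free : ∀ X : C, FreeAlg (sigmaFunctor V S') X)
    (B : Cᵒᵖ ⥤ C ⥤ C) where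
  app : ∀ (X : Under V) (Y : C),
    (sigmaFunctor V S').obj (X.right ⨯ (B.obj (op X.right)).obj Y) ⟶
      (B.obj (op X.right)).obj ((freeFunctor free).obj (X.right ⨿ Y))
  dinatural : ∀ {X X' : Under V} (f : X ⟶ X') (Y : C),
    (sigmaFunctor V S').map (Limits.prod.map f.right (𝟙 ((B.obj (op X'.right)).obj Y))) ≫
        app X' Y ≫ (B.map f.right.op).app ((freeFunctor free).obj (X'.right ⨿ Y)) =
      (sigmaFunctor V S').map (Limits.prod.map (𝟙 X.right) ((B.map f.right.op).app Y)) ≫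
        app X Y ≫
          (B.obj (op X.right)).map ((freeFunctor free).map (coprod.map f.right (𝟙 Y)))
  natural : ∀ (X : Under V) {Y Y' : C} (g : Y ⟶ Y'),
    (sigmaFunctor V S').map (Limits.prod.map (𝟙 X.right) ((B.obj (op X.right)).map g)) ≫
        app X Y' =
      app X Y ≫
        (B.obj (op X.right)).map ((freeFunctor free).map (coprod.map (𝟙 X.right) g))

namespace HOGSOSLaw

variable {V : C} {S' : C ⥤ C} {free : ∀ X : C, FreeAlg (sigmaFunctor V S') X}
  {B : Cᵒᵖ ⥤ C ⥤ C}

/-- For a `Σ`-algebra `A`, the composite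
`Σ (A × B(A, A)) ⟶ B(A, Σ⋆ (A + A)) ⟶ B(A, Σ⋆ A) ⟶ B(A, A)`
of the law with the codiagonal and the evaluation `â`. -/
def act (ρ : HOGSOSLaw V S' free B) (A : Endofunctor.Algebra (sigmaFunctor V S')) :
    (sigmaFunctor V S').obj (A.a ⨯ (B.obj (op A.a)).obj A.a) ⟶ (B.obj (op A.a)).obj A.a :=
  ρ.app (point A) A.a ≫
    (B.obj (op A.a)).map ((freeFunctor free).map (coprod.desc (𝟙 A.a) (𝟙 A.a))) ≫
      (B.obj (op A.a)).map (evalHat free A)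

/-- The operational model `γ : μΣ ⟶ B(μΣ, μΣ)`, defined by primitive recursion. -/
def operationalModel (ρ : HOGSOSLaw V S' free B)
    {M : Endofunctor.Algebra (sigmaFunctor V S')} (hM : IsInitial M) :
    M.a ⟶ (B.obj (op M.a)).obj M.a :=
  primRec hM (ρ.act M)

/-- `(A, a, c)` is a lax bialgebra for the law. -/
def IsLaxBialgebra (ρ : HOGSOSLaw V S' free B) (P : ∀ X Y : C, PreorderOn ((B.obj (op X)).obj Y))
    (A : Endofunctor.Algebra (sigmaFunctor V S')) (c : A.a ⟶ (B.obj (op A.a)).obj A.a) : Prop :=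
  (P A.a A.a).le ((sigmaFunctor V S').map (prod.lift (𝟙 A.a) c) ≫ ρ.act A) (A.str ≫ c)

end HOGSOSLaw

end

/-- The law `ρ` admits a relation lifting along `B̄`: each component of `ρ` at a `V`-pointed object
underlying a `(V, V)`-pointed relation `(X, R)` and at an object underlying a relation `(Y, S)`
is a morphism of relations
`Σ̄ ((X, R) × B̄((X, R), (Y, S))) ⟶ B̄((X, R), Σ̄⋆ ((X, R) ∨ (Y, S)))`,
where `Σ̄` and `Σ̄⋆` are the canonical relation liftings of `Σ` and `Σ⋆`. Dinaturality and
naturality of the lifted family are inherited from `ρ`, since morphisms of relations are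
determined by their base components. -/
def HOGSOSLaw.HasRelLifting {C : Type u} [Category.{v} C] [HasLimits C] [WellPowered.{v} C]
    [HasBinaryCoproducts C] {V : C} {S' : C ⥤ C}
    {free : ∀ X : C, FreeAlg (sigmaFunctor V S') X} {B : Cᵒᵖ ⥤ C ⥤ C}
    (ρ : HOGSOSLaw V S' free B) (L : BiRelLifting B) : Prop :=
  ∀ (X : Under V) (Y : C) (R : Relation X.right) (S : Relation Y),
    (Relation.idRel V).toGraph.IsHom X.hom R.toGraph →
    ((canonicalLifting (sigmaFunctor V S')).rel (R.prod (L.rel R S))).toGraph.IsHom (ρ.app X Y)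
      (L.rel R ((canonicalLifting (freeFunctor free)).rel (R.sum S))).toGraph

end

end HOGSOS

/-!
Let `X = μΣ` and let `H` be the Howe closure of `R`. Since `R` is reflexive, `H` is a reflexive
congruence: `ι` is a morphism of relations `Σ̄ H ⟶ H`. Since `R` is transitive, `H • R ≤ H`
(`howeClosure_comp_le`); this is where local distributivity and the pullback stability of strong
epimorphisms enter, as they make composition with `R` distribute over the join defining `H` and
associate laxly.

The relation lifting of the law shows (`graphLe_act`) that if a graph is contained in a reflexive
congruence `H` and its two legs, followed by `c` and `c'`, land in `B̄(H, H)`, then so do the legs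
of its image under `Σ`, followed by the transition maps which the law derives from `c` and `c'`.
Applied to `c = c' = γ`, structural induction on `μΣ` puts `(γ p, γ p)` in `B̄(H, H)` for every
`p` (`operationalModel_diag`).

Finally let `S ≤ H` consist of the pairs `(p, q)` in `H` with `(γ p, γ' q)` in `B̄(H, H)`. It is a
pre-fixed point of the map defining `H`, hence equal to `H`:
* `R ≤ S`, as `(γ p, γ p) ∈ B̄(H, H)` and `(γ p, γ' q) ∈ B̄((X, X), R)` compose to a pair
  in `B̄(H, H • R) ≤ B̄(H, H)`;
* `ι` maps `Σ̄ S` to `S`, by the relation lifting of the law for `γ` and `γ'`, the lax bialgebra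
  inequality and goodness for simulations;
* `S • R ≤ S`, as `R` is a simulation for `γ'` (`γ'` is a weakening) and `H • R ≤ H`.

Since `H` is reflexive, `B̄(H, H) ≤ B̄((X, X), H)`, so `H ≤ S` says that `H` is a weak simulation.
The detour through the smaller relation `B̄(H, H)` is needed because the lifting of the law takes
pairs of programs related by `T` to pairs in `B̄(T, -)`, and the arguments of `ι` are only related
by `H`, not equal.
-/

namespace HOGSOS

noncomputable section

/-! ### Graph morphisms, generated relations and composition -/

section

variable {C : Type u} [Category.{v} C]

theorem Graph.Le.isHom {X : C} {G H : Graph X} (h : G.Le H) : G.IsHom (𝟙 X) H := by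
  obtain ⟨h, h₁, h₂⟩ := h
  exact ⟨h, by simpa, by simpa⟩

theorem Graph.IsHom.comp {X Y Z : C} {f : X ⟶ Y} {g : Y ⟶ Z} {G : Graph X} {H : Graph Y}
    {K : Graph Z} (h : G.IsHom f H) (k : H.IsHom g K) : G.IsHom (f ≫ g) K := by
  obtain ⟨h, h₁, h₂⟩ := h
  obtain ⟨k, k₁, k₂⟩ := k
  exact ⟨h ≫ k, by rw [Category.assoc, k₁, reassoc_of% h₁],
    by rw [Category.assoc, k₂, reassoc_of% h₂]⟩

theorem Graph.Le.trans_isHom {X Y : C} {f : X ⟶ Y} {G H : Graph X} {K : Graph Y}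
    (h : G.Le H) (k : H.IsHom f K) : G.IsHom f K := by
  simpa using h.isHom.comp k

theorem Graph.comp_le_comp [HasPullbacks C] {X : C} {G G' K K' : Graph X} (h : G.Le G')
    (k : K.Le K') : (G.comp K).Le (G'.comp K') := by
  obtain ⟨h, h₁, h₂⟩ := h
  obtain ⟨k, k₁, k₂⟩ := k
  refine ⟨pullback.lift (pullback.fst G.outr K.outl ≫ h) (pullback.snd G.outr K.outl ≫ k) ?_,
    ?_, ?_⟩
  · simp [h₂, k₁, pullback.condition]
  · simp [pullback.lift_fst_assoc, h₁]
  · simp [pullback.lift_snd_assoc, k₂]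

theorem Graph.comp_assoc_le [HasPullbacks C] {X : C} (G H K : Graph X) :
    ((G.comp H).comp K).Le (G.comp (H.comp K)) := by
  let a := pullback.fst (G.comp H).outr K.outl
  let b := pullback.snd (G.comp H).outr K.outl
  have hab : a ≫ pullback.snd G.outr H.outl ≫ H.outr = b ≫ K.outl := pullback.condition
  refine ⟨pullback.lift (a ≫ pullback.fst _ _)
    (pullback.lift (a ≫ pullback.snd _ _) b (by simpa using hab)) ?_, ?_, ?_⟩
  · change _ = _ ≫ pullback.fst H.outr K.outl ≫ H.outl
    rw [pullback.lift_fst_assoc, Category.assoc, Category.assoc, pullback.condition]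
  · change _ ≫ pullback.fst _ _ ≫ _ = a ≫ _ ≫ _
    rw [pullback.lift_fst_assoc, Category.assoc]
  · change _ ≫ pullback.snd G.outr (H.comp K).outl ≫ pullback.snd _ _ ≫ _ = b ≫ _
    rw [pullback.lift_snd_assoc, pullback.lift_snd_assoc]

/-- The coproduct in `C` of two objects over `X` is their coproduct in the slice over `X`. -/
def isColimitOverCoprod [HasBinaryCoproducts C] {X A A' : C} (a : A ⟶ X) (a' : A' ⟶ X) :
    IsColimit (BinaryCofan.mk
      (Over.homMk coprod.inl (coprod.inl_desc a a') : Over.mk a ⟶ Over.mk (coprod.desc a a'))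
      (Over.homMk coprod.inr (coprod.inr_desc a a') : Over.mk a' ⟶ Over.mk (coprod.desc a a'))) :=
  BinaryCofan.isColimitMk
    (fun s => Over.homMk (coprod.desc s.inl.left s.inr.left) (by
      apply coprod.hom_ext
      · exact (coprod.inl_desc_assoc _ _ _).trans ((Over.w s.inl).trans (coprod.inl_desc _ _).symm)
      · exact (coprod.inr_desc_assoc _ _ _).trans
          ((Over.w s.inr).trans (coprod.inr_desc _ _).symm)))
    (fun s => Over.OverMorphism.ext (coprod.inl_desc _ _))
    (fun s => Over.OverMorphism.ext (coprod.inr_desc _ _))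
    (fun s m h₁ h₂ => Over.OverMorphism.ext (by
      apply coprod.hom_ext
      · exact (congrArg Over.Hom.left h₁).trans (coprod.inl_desc _ _).symm
      · exact (congrArg Over.Hom.left h₂).trans (coprod.inr_desc _ _).symm))

/-- Composition of graphs preserves binary coproducts in its first argument, up to `Graph.Le`.
The composite of a graph `G` with `K` is computed by the product of `G.outr` and `K.outl` in the
slice over `X`, which preserves coproducts by local distributivity. -/
theorem Graph.sumOver_comp_le [HasPullbacks C] [HasBinaryCoproducts C]
    (hC : LocallyDistributive C) {X : C} {G H K T : Graph X}
    (hG : (G.comp K).Le T) (hH : (H.comp K).Le T) : ((G.sumOver H).comp K).Le T := by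
  have := (hC X).finiteProducts
  have := (hC X).finiteCoproducts
  obtain ⟨g, g₁, g₂⟩ := hG
  obtain ⟨h, h₁, h₂⟩ := hH
  have cond : ∀ {A : C} (a : A ⟶ X),
      (Limits.prod.snd : Over.mk K.outl ⨯ Over.mk a ⟶ Over.mk a).left ≫ a =
        (Limits.prod.fst : Over.mk K.outl ⨯ Over.mk a ⟶ Over.mk K.outl).left ≫ K.outl :=
    fun a => (Over.w _).trans (Over.w _).symm
  obtain ⟨i₁, i₂, hi₁, hi₂, ⟨hF⟩⟩ :
      ∃ (i₁ : Over.mk G.outr ⟶ Over.mk (coprod.desc G.outr H.outr))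
        (i₂ : Over.mk H.outr ⟶ Over.mk (coprod.desc G.outr H.outr)),
        i₁.left = coprod.inl ∧ i₂.left = coprod.inr ∧
          Nonempty (IsColimit (BinaryCofan.mk (prod.map (𝟙 (Over.mk K.outl)) i₁).left
            (prod.map (𝟙 (Over.mk K.outl)) i₂).left)) := by
    have := (hC X).preserves (Over.mk K.outl)
    exact ⟨_, _, rfl, rfl, ⟨mapIsColimitOfPreservesOfIsColimit
      (prod.functor.obj (Over.mk K.outl) ⋙ Over.forget X) _ _
      (isColimitOverCoprod G.outr H.outr)⟩⟩
  obtain ⟨q, q₁, q₂⟩ : ∃ q,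
      (prod.map (𝟙 (Over.mk K.outl)) i₁).left ≫ q =
        pullback.lift (f := G.outr) (g := K.outl) _ _ (cond G.outr) ≫ g ∧
      (prod.map (𝟙 (Over.mk K.outl)) i₂).left ≫ q =
        pullback.lift (f := H.outr) (g := K.outl) _ _ (cond H.outr) ≫ h :=
    ⟨hF.desc (BinaryCofan.mk _ _), hF.fac _ ⟨WalkingPair.left⟩, hF.fac _ ⟨WalkingPair.right⟩⟩
  have ql : q ≫ T.outl = (Limits.prod.snd : Over.mk K.outl ⨯ Over.mk (coprod.desc G.outr H.outr) ⟶
      _).left ≫ coprod.desc G.outl H.outl := by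
    refine BinaryCofan.IsColimit.hom_ext hF ?_ ?_
    · have e := congrArg Over.Hom.left (prod.map_snd (𝟙 (Over.mk K.outl)) i₁)
      rw [Over.comp_left, Over.comp_left, hi₁] at e
      refine ((reassoc_of% q₁) T.outl).trans (Eq.trans ?_ ((reassoc_of% e) _).symm)
      rw [g₁, coprod.inl_desc, pullback.lift_fst_assoc]
    · have e := congrArg Over.Hom.left (prod.map_snd (𝟙 (Over.mk K.outl)) i₂)
      rw [Over.comp_left, Over.comp_left, hi₂] at e
      refine ((reassoc_of% q₂) T.outl).trans (Eq.trans ?_ ((reassoc_of% e) _).symm)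
      rw [h₁, coprod.inr_desc, pullback.lift_fst_assoc]
  have qr : q ≫ T.outr = (Limits.prod.fst : Over.mk K.outl ⨯ Over.mk (coprod.desc G.outr H.outr) ⟶
      _).left ≫ K.outr := by
    refine BinaryCofan.IsColimit.hom_ext hF ?_ ?_
    · have e := congrArg Over.Hom.left (prod.map_fst (𝟙 (Over.mk K.outl)) i₁)
      rw [Over.comp_left, Category.comp_id] at e
      refine ((reassoc_of% q₁) T.outr).trans (Eq.trans ?_ ((reassoc_of% e) _).symm)
      rw [g₂, pullback.lift_snd_assoc]
    · have e := congrArg Over.Hom.left (prod.map_fst (𝟙 (Over.mk K.outl)) i₂)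
      rw [Over.comp_left, Category.comp_id] at e
      refine ((reassoc_of% q₂) T.outr).trans (Eq.trans ?_ ((reassoc_of% e) _).symm)
      rw [h₂, pullback.lift_snd_assoc]
  let p : Over.mk (pullback.snd (G.sumOver H).outr K.outl ≫ K.outl) ⟶
      Over.mk K.outl ⨯ Over.mk (coprod.desc G.outr H.outr) :=
    prod.lift (Over.homMk (pullback.snd _ _))
      (Over.homMk (pullback.fst (G.sumOver H).outr K.outl) pullback.condition)
  have pf : p.left ≫ (Limits.prod.fst : Over.mk K.outl ⨯ _ ⟶ _).left =
      pullback.snd (G.sumOver H).outr K.outl := congrArg Over.Hom.left (prod.lift_fst _ _)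
  have ps : p.left ≫ (Limits.prod.snd : Over.mk K.outl ⨯ _ ⟶ _).left =
      pullback.fst (G.sumOver H).outr K.outl := congrArg Over.Hom.left (prod.lift_snd _ _)
  refine ⟨p.left ≫ q, ?_, ?_⟩
  · rw [Category.assoc, ql]
    exact (reassoc_of% ps) _
  · rw [Category.assoc, qr]
    exact (reassoc_of% pf) _

end

namespace Relation

section

variable {C : Type u} [Category.{v} C] [HasBinaryProducts C]

/-- Being contained in a relation may be tested after precomposition with a strong epimorphism. -/
theorem graphLe_of_strongEpi {X : C} {G : Graph X} {S : Relation X} {E : C} (e : E ⟶ G.E)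
    [StrongEpi e] (h : Graph.Le ⟨E, e ≫ G.outl, e ≫ G.outr⟩ S.toGraph) : G.Le S.toGraph := by
  obtain ⟨k, k₁, k₂⟩ := h
  have := S.mono_pair
  have sq : CommSq k e S.toGraph.pair G.pair := ⟨by
    apply Limits.prod.hom_ext <;> simp [*]⟩
  refine ⟨sq.lift, ?_, ?_⟩
  · rw [← Graph.pair_fst S.toGraph, ← Category.assoc, sq.fac_right, Graph.pair_fst]
  · rw [← Graph.pair_snd S.toGraph, ← Category.assoc, sq.fac_right, Graph.pair_snd]

end

variable {C : Type u} [Category.{v} C] [HasLimits C] [WellPowered.{v} C]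

theorem exists_strongEpi_dag {X : C} (G : Graph X) :
    ∃ e : G.E ⟶ (dag G).E, StrongEpi e ∧ e ≫ (dag G).outl = G.outl ∧ e ≫ (dag G).outr = G.outr :=
  have h : StrongEpi (factorThruImage G.pair) := inferInstance
  ⟨factorThruImage G.pair, h, by simp [dag], by simp [dag]⟩

theorem dag_comp_le (hC : StrongEpisPullbackStable C) {X : C} {G K : Graph X} {S : Relation X}
    (h : (G.comp K).Le S.toGraph) : ((dag G).toGraph.comp K).Le S.toGraph := by
  obtain ⟨h, h₁, h₂⟩ := h
  obtain ⟨e, he, hl, hr⟩ := exists_strongEpi_dag G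
  let p := pullback.fst (dag G).outr K.outl
  have hp : IsPullback (pullback.snd e p) (pullback.fst e p) p e :=
    (IsPullback.of_hasPullback e p).flip
  have : StrongEpi (pullback.snd e p) := hC hp he
  refine graphLe_of_strongEpi (pullback.snd e p) ⟨pullback.lift (pullback.fst e p)
    (pullback.snd e p ≫ pullback.snd _ _) ?_ ≫ h, ?_, ?_⟩
  · rw [← hr, reassoc_of% (pullback.condition (f := e) (g := p)), Category.assoc,
      ← pullback.condition]
  · rw [Category.assoc, h₁, pullback.lift_fst_assoc, ← hl,
      reassoc_of% (pullback.condition (f := e) (g := p))]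
  · rw [Category.assoc, h₂, pullback.lift_snd_assoc, Category.assoc]

theorem le_comp_of_isReflexive {X : C} (S : Relation X) {R : Relation X} (hR : R.IsReflexive) :
    S ≤ S.comp R := by
  obtain ⟨h, h₁, h₂⟩ := hR
  refine le_trans (le_def.2 ?_) (comp_mono le_rfl (le_def.2 ⟨h, h₁, h₂⟩))
  exact Graph.Le.trans ⟨pullback.lift (𝟙 _) S.outr (by simp),
    (pullback.lift_fst_assoc _ _ _ _).trans (Category.id_comp _),
    (pullback.lift_snd_assoc _ _ _ _).trans (Category.comp_id _)⟩ (le_dag _)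

theorem comp_assoc_le (hC : StrongEpisPullbackStable C) {X : C} (R S T : Relation X) :
    (R.comp S).comp T ≤ R.comp (S.comp T) :=
  dag_le (dag_comp_le hC ((Graph.comp_assoc_le _ _ _).trans
    ((Graph.comp_le_comp ⟨𝟙 _, by simp, by simp⟩ (le_dag _)).trans (le_dag _))))

variable [HasBinaryCoproducts C]

theorem le_join_left {X : C} (R S : Relation X) : R ≤ R.join S :=
  Graph.Le.trans (H := R.toGraph.sumOver S.toGraph)
    ⟨coprod.inl, coprod.inl_desc _ _, coprod.inl_desc _ _⟩ (le_dag _)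

theorem le_join_right {X : C} (R S : Relation X) : S ≤ R.join S :=
  Graph.Le.trans (H := R.toGraph.sumOver S.toGraph)
    ⟨coprod.inr, coprod.inr_desc _ _, coprod.inr_desc _ _⟩ (le_dag _)

theorem join_le {X : C} {R S T : Relation X} (h : R ≤ T) (k : S ≤ T) : R.join S ≤ T := by
  obtain ⟨h, h₁, h₂⟩ := h
  obtain ⟨k, k₁, k₂⟩ := k
  exact dag_le ⟨coprod.desc h k, by ext <;> simp [*], by ext <;> simp [*]⟩

theorem join_comp_le (hC : StrongEpisPullbackStable C) (hC' : LocallyDistributive C) {X : C}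
    {R S T U : Relation X} (h : R.comp T ≤ U) (k : S.comp T ≤ U) : (R.join S).comp T ≤ U :=
  dag_le (dag_comp_le hC (Graph.sumOver_comp_le hC' ((le_dag _).trans h) ((le_dag _).trans k)))

/-- The codiagonal is a morphism of relations `(X, R) ∨ (X, R) ⟶ (X, R)`. -/
theorem sum_isHom_codiag {X : C} (R : Relation X) :
    (R.sum R).toGraph.IsHom (coprod.desc (𝟙 X) (𝟙 X)) R.toGraph :=
  dag_isHom ⟨coprod.desc (𝟙 _) (𝟙 _), by ext <;> simp, by ext <;> simp⟩

end Relation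

/-! ### The Howe closure -/

section

variable {C : Type u} [Category.{v} C] [HasLimits C] [WellPowered.{v} C] [HasBinaryCoproducts C]
  (F : C ⥤ C) {X : C} (ξ : F.obj X ⟶ X) (hξ : Mono ξ) (R : Relation X)

theorem howeClosure_le {T : Relation X} (hT : (howeFunctor F ξ hξ R).obj T ≤ T) :
    howeClosure F ξ hξ R ≤ T := by
  have := hasInitial_howe F ξ hξ R
  let A : Endofunctor.Algebra (howeFunctor F ξ hξ R) := ⟨T, homOfLE hT⟩
  exact leOfHom (initial.to A).f

theorem howeFunctor_howeClosure_le :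
    (howeFunctor F ξ hξ R).obj (howeClosure F ξ hξ R) ≤ howeClosure F ξ hξ R := by
  have := hasInitial_howe F ξ hξ R
  exact leOfHom (⊥_ (Endofunctor.Algebra (howeFunctor F ξ hξ R))).str

theorem howeClosure_le_howeFunctor :
    howeClosure F ξ hξ R ≤ (howeFunctor F ξ hξ R).obj (howeClosure F ξ hξ R) :=
  howeClosure_le F ξ hξ R (leOfHom ((howeFunctor F ξ hξ R).map
    (homOfLE (howeFunctor_howeClosure_le F ξ hξ R))))

theorem le_howeClosure : R ≤ howeClosure F ξ hξ R :=
  (Relation.le_join_left _ _).trans (howeFunctor_howeClosure_le F ξ hξ R)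

/-- The Howe closure of a reflexive relation is a congruence. -/
theorem howeClosure_isHom (hR : R.IsReflexive) :
    ((canonicalLifting F).rel (howeClosure F ξ hξ R)).toGraph.IsHom ξ
      (howeClosure F ξ hξ R).toGraph := by
  have h : ((canonicalLifting F).rel (howeClosure F ξ hξ R)).push ξ hξ ≤ howeClosure F ξ hξ R :=
    (Relation.le_comp_of_isReflexive _ hR).trans
      ((Relation.le_join_right _ _).trans (howeFunctor_howeClosure_le F ξ hξ R))
  exact h

/-- The Howe closure of a transitive relation `R` absorbs `R` on the right. -/
theorem howeClosure_comp_le (hC : StrongEpisPullbackStable C) (hC' : LocallyDistributive C)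
    (hR : R.IsTransitive) : (howeClosure F ξ hξ R).comp R ≤ howeClosure F ξ hξ R := by
  refine (Relation.comp_mono (howeClosure_le_howeFunctor F ξ hξ R) le_rfl).trans ?_
  refine Relation.join_comp_le hC hC' (hR.trans (le_howeClosure F ξ hξ R)) ?_
  exact (Relation.comp_assoc_le hC _ _ _).trans ((Relation.comp_mono le_rfl hR).trans
    ((Relation.le_join_right _ _).trans (howeFunctor_howeClosure_le F ξ hξ R)))

end

/-! ### Congruences and free algebras -/

section

variable {C : Type u} [Category.{v} C] [HasLimits C] [WellPowered.{v} C]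

theorem exists_canonicalLifting (F : C ⥤ C) {X : C} (R : Relation X) :
    ∃ d : F.obj R.E ⟶ ((canonicalLifting F).rel R).E,
      d ≫ ((canonicalLifting F).rel R).outl = F.map R.outl ∧
        d ≫ ((canonicalLifting F).rel R).outr = F.map R.outr :=
  Relation.le_dag (R.toGraph.mapFunctor F)

/-- A congruence on a `Σ`-algebra is a congruence for the induced `Σ⋆`-algebra structure: it
carries a `Σ`-algebra structure of its own for which both projections are homomorphisms. -/
theorem canonicalLifting_freeFunctor_isHom {F : C ⥤ C} (free : ∀ X : C, FreeAlg F X)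
    (A : Endofunctor.Algebra F) {H : Relation A.a}
    (hH : ((canonicalLifting F).rel H).toGraph.IsHom A.str H.toGraph) :
    ((canonicalLifting (freeFunctor free)).rel H).toGraph.IsHom (evalHat free A) H.toGraph := by
  obtain ⟨k, k₁, k₂⟩ := hH
  obtain ⟨d, d₁, d₂⟩ := exists_canonicalLifting F H
  let A' : Endofunctor.Algebra F := ⟨H.E, d ≫ k⟩
  let l : A' ⟶ A := ⟨H.outl, by
    change F.map H.outl ≫ A.str = (d ≫ k) ≫ H.outl
    rw [Category.assoc, k₁, ← d₁, Category.assoc]⟩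
  let r : A' ⟶ A := ⟨H.outr, by
    change F.map H.outr ≫ A.str = (d ≫ k) ≫ H.outr
    rw [Category.assoc, k₂, ← d₂, Category.assoc]⟩
  have nat : ∀ f : A' ⟶ A,
      evalHat free A' ≫ f.f = (freeFunctor free).map f.f ≫ evalHat free A := by
    intro f
    have e₁ := (free A'.a).uniq A f.f ((free A'.a).ext A' (𝟙 _) ≫ f) (by
      rw [Endofunctor.Algebra.comp_f, ← Category.assoc, (free A'.a).fac]
      exact Category.id_comp _)
    have e₂ := (free A'.a).uniq A f.f
      ((free A'.a).ext (free A.a).alg (f.f ≫ (free A.a).unit) ≫ (free A.a).ext A (𝟙 _)) (by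
      rw [Endofunctor.Algebra.comp_f, ← Category.assoc, (free A'.a).fac, Category.assoc,
        (free A.a).fac]
      exact Category.comp_id _)
    exact congrArg Endofunctor.Algebra.Hom.f (e₁.trans e₂.symm)
  exact Relation.dag_isHom ⟨evalHat free A', nat l, nat r⟩

end

/-! ### Transitions derived from the law -/

section

variable {C : Type u} [Category.{v} C] [HasLimits C] [WellPowered.{v} C] [HasBinaryCoproducts C]
  {V : C} {S' : C ⥤ C} {free : ∀ X : C, FreeAlg (sigmaFunctor V S') X} {B : Cᵒᵖ ⥤ C ⥤ C}
  {ρ : HOGSOSLaw V S' free B} {L : BiRelLifting B}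

theorem HOGSOSLaw.HasRelLifting.act_isHom (hρ : ρ.HasRelLifting L)
    {A : Endofunctor.Algebra (sigmaFunctor V S')} {H : Relation A.a} (hrefl : H.IsReflexive)
    (hcong : ((canonicalLifting (sigmaFunctor V S')).rel H).toGraph.IsHom A.str H.toGraph) :
    ((canonicalLifting (sigmaFunctor V S')).rel (H.prod (L.rel H H))).toGraph.IsHom (ρ.act A)
      (L.rel H H).toGraph := by
  have hpt : (Relation.idRel V).toGraph.IsHom (point A).hom H.toGraph := by
    obtain ⟨h, h₁, h₂⟩ := hrefl
    exact ⟨(point A).hom ≫ h,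
      (Category.assoc _ _ _).trans ((congrArg (_ ≫ ·) h₁).trans
        ((Category.comp_id _).trans (Category.id_comp _).symm)),
      (Category.assoc _ _ _).trans ((congrArg (_ ≫ ·) h₂).trans
        ((Category.comp_id _).trans (Category.id_comp _).symm))⟩
  exact (hρ (point A) A.a H H hpt).comp (((L.at H).isHom_map _ _ _
    ((canonicalLifting (freeFunctor free)).isHom_map _ _ _ H.sum_isHom_codiag)).comp
      ((L.at H).isHom_map _ _ _ (canonicalLifting_freeFunctor_isHom free A hcong)))

/-- If a graph on a `Σ`-algebra `A` is contained in a reflexive congruence `H` and `c`, `c'` map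
it into `B̄(H, H)`, then the transitions derived from `c` and `c'` by the law map its image under
`Σ` into `B̄(H, H)`. -/
theorem graphLe_act (hρ : ρ.HasRelLifting L)
    {A : Endofunctor.Algebra (sigmaFunctor V S')} {H : Relation A.a} (hrefl : H.IsReflexive)
    (hcong : ((canonicalLifting (sigmaFunctor V S')).rel H).toGraph.IsHom A.str H.toGraph)
    {c c' : A.a ⟶ (B.obj (op A.a)).obj A.a} {G : Graph A.a} (hG : G.Le H.toGraph)
    (hG' : Graph.Le ⟨G.E, G.outl ≫ c, G.outr ≫ c'⟩ (L.rel H H).toGraph) :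
    Graph.Le ⟨(sigmaFunctor V S').obj G.E,
      (sigmaFunctor V S').map G.outl ≫ (sigmaFunctor V S').map (prod.lift (𝟙 _) c) ≫ ρ.act A,
      (sigmaFunctor V S').map G.outr ≫ (sigmaFunctor V S').map (prod.lift (𝟙 _) c') ≫ ρ.act A⟩
      (L.rel H H).toGraph := by
  obtain ⟨k, k₁, k₂⟩ := hρ.act_isHom hrefl hcong
  obtain ⟨d, d₁, d₂⟩ := exists_canonicalLifting (sigmaFunctor V S') (H.prod (L.rel H H))
  obtain ⟨g, g₁, g₂⟩ := hG
  obtain ⟨g', g₁', g₂'⟩ := hG'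
  refine ⟨(sigmaFunctor V S').map (prod.lift g g') ≫ d ≫ k, ?_, ?_⟩
  · rw [Category.assoc, Category.assoc, k₁]
    rw [reassoc_of% d₁]
    simp only [← Category.assoc, ← Functor.map_comp]
    congr 2
    apply Limits.prod.hom_ext <;> simp [g₁, g₁']
  · rw [Category.assoc, Category.assoc, k₂]
    rw [reassoc_of% d₂]
    simp only [← Category.assoc, ← Functor.map_comp]
    congr 2
    apply Limits.prod.hom_ext <;> simp [g₂, g₂']

end

theorem HOGSOSLaw.str_comp_operationalModel {C : Type u} [Category.{v} C] [HasBinaryProducts C]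
    [HasBinaryCoproducts C] {V : C} {S' : C ⥤ C}
    {free : ∀ X : C, FreeAlg (sigmaFunctor V S') X} {B : Cᵒᵖ ⥤ C ⥤ C}
    (ρ : HOGSOSLaw V S' free B) {M : Endofunctor.Algebra (sigmaFunctor V S')}
    (hM : IsInitial M) :
    M.str ≫ ρ.operationalModel hM =
      (sigmaFunctor V S').map (prod.lift (𝟙 _) (ρ.operationalModel hM)) ≫ ρ.act M :=
  (primRec_iff hM (ρ.act M) _).2 rfl

/-- The operational model relates every program to itself in `B̄(H, H)`, for every reflexive
congruence `H`. The programs with this property form a subalgebra of the initial algebra. -/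
theorem operationalModel_diag {C : Type u} [Category.{v} C] [HasLimits C] [WellPowered.{v} C]
    [HasBinaryCoproducts C] {V : C} {S' : C ⥤ C}
    {free : ∀ X : C, FreeAlg (sigmaFunctor V S') X} {B : Cᵒᵖ ⥤ C ⥤ C}
    {ρ : HOGSOSLaw V S' free B} {L : BiRelLifting B} (hρ : ρ.HasRelLifting L)
    {M : Endofunctor.Algebra (sigmaFunctor V S')} (hM : IsInitial M) {H : Relation M.a}
    (hrefl : H.IsReflexive)
    (hcong : ((canonicalLifting (sigmaFunctor V S')).rel H).toGraph.IsHom M.str H.toGraph) :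
    ∃ g : M.a ⟶ (L.rel H H).E, g ≫ (L.rel H H).outl = ρ.operationalModel hM ∧
      g ≫ (L.rel H H).outr = ρ.operationalModel hM := by
  set γ := ρ.operationalModel hM with hγ
  -- `p` is the subobject of all programs related to themselves
  let d := (L.rel H H).toGraph.pair
  let p := pullback.fst (prod.lift γ γ) d
  let s := pullback.snd (prod.lift γ γ) d
  have hps : p ≫ prod.lift γ γ = s ≫ d := pullback.condition
  have s₁ : s ≫ (L.rel H H).outl = p ≫ γ := by
    have e := congrArg (· ≫ Limits.prod.fst) hps
    simp only [Category.assoc, d, Graph.pair_fst] at e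
    exact e.symm.trans (congrArg (p ≫ ·) (prod.lift_fst _ _))
  have s₂ : s ≫ (L.rel H H).outr = p ≫ γ := by
    have e := congrArg (· ≫ Limits.prod.snd) hps
    simp only [Category.assoc, d, Graph.pair_snd] at e
    exact e.symm.trans (congrArg (p ≫ ·) (prod.lift_snd _ _))
  obtain ⟨h, h₁, h₂⟩ := hrefl
  obtain ⟨k, k₁, k₂⟩ := graphLe_act hρ ⟨h, h₁, h₂⟩ hcong (c := γ) (c' := γ)
    (G := ⟨_, p, p⟩) ⟨p ≫ h, by simp [h₁], by simp [h₂]⟩ ⟨s, s₁, s₂⟩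
  rw [← ρ.str_comp_operationalModel hM, ← hγ] at k₁ k₂
  let A : Endofunctor.Algebra (sigmaFunctor V S') :=
    ⟨_, pullback.lift (f := prod.lift γ γ) (g := d) ((sigmaFunctor V S').map p ≫ M.str) k (by
      apply Limits.prod.hom_ext
      · rw [Category.assoc, Category.assoc, Category.assoc, prod.lift_fst, Graph.pair_fst, k₁]
      · rw [Category.assoc, Category.assoc, Category.assoc, prod.lift_snd, Graph.pair_snd, k₂])⟩
  let f : A ⟶ M := ⟨p, (pullback.lift_fst _ _ _).symm⟩
  have hf : (hM.to A).f ≫ p = 𝟙 M.a :=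
    congrArg Endofunctor.Algebra.Hom.f (hM.hom_ext (hM.to A ≫ f) (𝟙 M))
  exact ⟨(hM.to A).f ≫ s, by rw [Category.assoc, s₁, reassoc_of% hf],
    by rw [Category.assoc, s₂, reassoc_of% hf]⟩

/-! ### Composing transitions with those of a simulation -/

theorem BiRelLifting.rel_le_rel {C : Type u} [Category.{v} C] [HasBinaryProducts C]
    {B : Cᵒᵖ ⥤ C ⥤ C} (L : BiRelLifting B) {X Y : C} {R R' : Relation X}
    {S S' : Relation Y} (hR : R' ≤ R) (hS : S ≤ S') : L.rel R S ≤ L.rel R' S' := by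
  obtain ⟨n, n₁, n₂⟩ := L.isHom_map (𝟙 X) (𝟙 Y) R R' S S' (Graph.Le.isHom hR) (Graph.Le.isHom hS)
  simp only [op_id, CategoryTheory.Functor.map_id, NatTrans.id_app, Category.comp_id] at n₁ n₂
  exact ⟨n, n₁, n₂⟩

section

variable {C : Type u} [Category.{v} C] [HasLimits C] [WellPowered.{v} C]

theorem Relation.exists_comp {X : C} (R S : Relation X) {E : C} (a : E ⟶ R.E) (b : E ⟶ S.E)
    (h : a ≫ R.outr = b ≫ S.outl) :
    ∃ l : E ⟶ (R.comp S).E, l ≫ (R.comp S).outl = a ≫ R.outl ∧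
      l ≫ (R.comp S).outr = b ≫ S.outr :=
  Graph.Le.trans (G := ⟨E, a ≫ R.outl, b ≫ S.outr⟩) (H := R.toGraph.comp S.toGraph)
    ⟨pullback.lift a b h, pullback.lift_fst_assoc _ _ _ _, pullback.lift_snd_assoc _ _ _ _⟩
    (le_dag _)

/-- If `S • R ≤ S`, pairs in `B̄(T, S)` and in `B̄((X, X), R)` compose to pairs in
`B̄(T, S)`. -/
theorem BiRelLifting.IsGoodForSimulations.exists_comp {B : Cᵒᵖ ⥤ C ⥤ C} {L : BiRelLifting B}
    {P : ∀ X Y : C, PreorderOn ((B.obj (op X)).obj Y)} (hL : L.IsGoodForSimulations P) {X Y : C}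
    (T : Relation X) {S R : Relation Y} (h : S.comp R ≤ S) {E : C} (a : E ⟶ (L.rel T S).E)
    (b : E ⟶ (L.rel (Relation.idRel X) R).E)
    (hab : a ≫ (L.rel T S).outr = b ≫ (L.rel (Relation.idRel X) R).outl) :
    ∃ l : E ⟶ (L.rel T S).E, l ≫ (L.rel T S).outl = a ≫ (L.rel T S).outl ∧
      l ≫ (L.rel T S).outr = b ≫ (L.rel (Relation.idRel X) R).outr := by
  obtain ⟨l, l₁, l₂⟩ := Relation.exists_comp _ _ a b hab
  obtain ⟨m, m₁, m₂⟩ := (hL.comp_le T S R).trans (L.rel_le_rel le_rfl h)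
  exact ⟨l ≫ m, by rw [Category.assoc, m₁, l₁], by rw [Category.assoc, m₂, l₂]⟩

end

/-! ### Restricting a relation along a pair of morphisms -/

section

variable {C : Type u} [Category.{v} C] [HasLimits C]

/-- The relation of all pairs `(p, q)` in `H` such that `(c p, c' q)` is in `T`. -/
def Relation.restrict {X Y : C} (H : Relation X) (c c' : X ⟶ Y) (T : Relation Y) :
    Relation X where
  E := pullback (H.toGraph.pair ≫ prod.map c c') T.toGraph.pair
  outl := pullback.fst _ _ ≫ H.outl
  outr := pullback.fst _ _ ≫ H.outr
  mono_pair := by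
    have := H.mono_pair
    have := T.mono_pair
    have h : Graph.pair ⟨pullback (H.toGraph.pair ≫ prod.map c c') T.toGraph.pair,
        pullback.fst _ _ ≫ H.outl, pullback.fst _ _ ≫ H.outr⟩ =
        pullback.fst _ _ ≫ H.toGraph.pair := by
      apply Limits.prod.hom_ext <;> simp
    rw [h]
    infer_instance

variable {X Y : C} (H : Relation X) (c c' : X ⟶ Y) (T : Relation Y)

theorem Relation.restrict_le : H.restrict c c' T ≤ H :=
  le_def.2 ⟨pullback.fst _ _, rfl, rfl⟩

theorem Relation.exists_of_restrict :
    ∃ s : (H.restrict c c' T).E ⟶ T.E, s ≫ T.outl = (H.restrict c c' T).outl ≫ c ∧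
      s ≫ T.outr = (H.restrict c c' T).outr ≫ c' := by
  have h := pullback.condition (f := H.toGraph.pair ≫ prod.map c c') (g := T.toGraph.pair)
  refine ⟨pullback.snd _ _, ?_, ?_⟩
  · simpa [restrict] using (congrArg (· ≫ Limits.prod.fst) h).symm
  · simpa [restrict] using (congrArg (· ≫ Limits.prod.snd) h).symm

variable {H c c' T}

theorem Relation.graphLe_restrict {G : Graph X} (h : G.Le H.toGraph)
    (k : Graph.Le ⟨G.E, G.outl ≫ c, G.outr ≫ c'⟩ T.toGraph) :
    G.Le (H.restrict c c' T).toGraph := by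
  obtain ⟨h, h₁, h₂⟩ := h
  obtain ⟨k, k₁, k₂⟩ := k
  refine ⟨pullback.lift h k ?_, ?_, ?_⟩
  · apply Limits.prod.hom_ext <;> simp [k₁, k₂, reassoc_of% h₁, reassoc_of% h₂]
  · exact (pullback.lift_fst_assoc _ _ _ _).trans h₁
  · exact (pullback.lift_fst_assoc _ _ _ _).trans h₂

end

end

end HOGSOS

open HOGSOS in
theorem mainTheorem2 {C : Type u} [Category.{v} C] [HasLimits C] [HasColimits C]
    [WellPowered.{v} C]
    (hC : HOGSOS.StrongEpisPullbackStable C) (hC' : HOGSOS.LocallyDistributive C)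
    (V : C) (S' : C ⥤ C)
    (hS : HOGSOS.PreservesStrongEpis (HOGSOS.sigmaFunctor V S'))
    (free : ∀ X : C, HOGSOS.FreeAlg (HOGSOS.sigmaFunctor V S') X)
    (B : Cᵒᵖ ⥤ C ⥤ C)
    (P : ∀ X Y : C, HOGSOS.PreorderOn ((B.obj (op X)).obj Y))
    (L : HOGSOS.BiRelLifting B) (hL : L.IsGoodForSimulations P)
    (ρ : HOGSOS.HOGSOSLaw V S' free B) (hρ : ρ.HasRelLifting L)
    (M : Endofunctor.Algebra (HOGSOS.sigmaFunctor V S')) (hM : IsInitial M)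
    (γ' : M.a ⟶ (B.obj (op M.a)).obj M.a)
    (hγ' : HOGSOS.IsWeakening (L.at (HOGSOS.Relation.idRel M.a)) (ρ.operationalModel hM) γ')
    (hlax : ρ.IsLaxBialgebra P M γ')
    (R : HOGSOS.Relation M.a) (hrefl : R.IsReflexive) (htrans : R.IsTransitive)
    (hR : HOGSOS.IsWeakSimulation (L.at (HOGSOS.Relation.idRel M.a))
      (ρ.operationalModel hM) γ' R) :
    HOGSOS.IsWeakSimulation (L.at (HOGSOS.Relation.idRel M.a)) (ρ.operationalModel hM) γ'
      (HOGSOS.howeClosure (HOGSOS.sigmaFunctor V S') M.str (HOGSOS.mono_str hM) R) := by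
  let F := sigmaFunctor V S'
  set γ := ρ.operationalModel hM
  set H := howeClosure F M.str (mono_str hM) R
  have hRH : R ≤ H := le_howeClosure F M.str (mono_str hM) R
  have hHrefl : H.IsReflexive := le_trans hrefl hRH
  have hcong : ((canonicalLifting F).rel H).toGraph.IsHom M.str H.toGraph :=
    howeClosure_isHom F M.str (mono_str hM) R hrefl
  have hHR : H.comp R ≤ H := howeClosure_comp_le F M.str (mono_str hM) R hC hC' htrans
  obtain ⟨g, g₁, g₂⟩ := operationalModel_diag hρ hM hHrefl hcong
  obtain ⟨r', r₁', r₂'⟩ : ∃ r : R.E ⟶ (L.rel (Relation.idRel M.a) R).E,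
      r ≫ (L.rel (Relation.idRel M.a) R).outl = R.outl ≫ γ' ∧
        r ≫ (L.rel (Relation.idRel M.a) R).outr = R.outr ≫ γ' := (hγ' R).2 hR
  obtain ⟨r, r₁, r₂⟩ : ∃ r : R.E ⟶ (L.rel (Relation.idRel M.a) R).E,
      r ≫ (L.rel (Relation.idRel M.a) R).outl = R.outl ≫ γ ∧
        r ≫ (L.rel (Relation.idRel M.a) R).outr = R.outr ≫ γ' := hR
  let S := H.restrict γ γ' (L.rel H H)
  obtain ⟨s, s₁, s₂⟩ : ∃ s : S.E ⟶ (L.rel H H).E, s ≫ (L.rel H H).outl = S.outl ≫ γ ∧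
    s ≫ (L.rel H H).outr = S.outr ≫ γ' := Relation.exists_of_restrict H γ γ' (L.rel H H)
  have hSH : S ≤ H := Relation.restrict_le _ _ _ _
  have hRS : R ≤ S := by
    obtain ⟨l, l₁, l₂⟩ := hL.exists_comp H hHR (R.outl ≫ g) r (by rw [Category.assoc, g₂, r₁])
    exact Relation.graphLe_restrict hRH ⟨l, by rw [l₁, Category.assoc, g₁], l₂.trans r₂⟩
  have hSR : S.comp R ≤ S := by
    obtain ⟨l, l₁, l₂⟩ := hL.exists_comp H hHR (pullback.fst S.outr R.outl ≫ s)
      (pullback.snd S.outr R.outl ≫ r') (by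
        rw [Category.assoc, Category.assoc, s₂, r₁', pullback.condition_assoc])
    exact Relation.dag_le (Relation.graphLe_restrict
      ((Relation.le_dag _).trans ((Relation.comp_mono hSH le_rfl).trans hHR))
      ⟨l, by simpa only [Category.assoc, s₁] using l₁, by simpa only [Category.assoc, r₂'] using l₂⟩)
  have hSstr : ((canonicalLifting F).rel S).toGraph.IsHom M.str S.toGraph := by
    refine Relation.dag_isHom (?_ : ((S.toGraph.mapFunctor F).push M.str).Le S.toGraph)
    refine Relation.graphLe_restrict ?_ ?_
    · exact ((Relation.le_dag _).trans (canonicalLifting_mono F hSH)).trans_isHom hcong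
    -- The law derives transitions of `ι p` from those of `p`: for `γ` they are its own ones,
    -- for `γ'` they lie below its own ones, and goodness for simulations closes the gap.
    · obtain ⟨k, k₁, k₂⟩ := graphLe_act hρ hHrefl hcong hSH ⟨s, s₁, s₂⟩
      refine hL.good H H _ ⟨k, ?_, ?_⟩
      · rw [k₁, ← ρ.str_comp_operationalModel hM, Category.assoc]
      · rw [k₂]
        have := (P M.a M.a).precomp (F.map S.outr) _ _ hlax
        simpa only [Category.assoc] using this
  have hHS : H ≤ S := howeClosure_le F M.str (mono_str hM) R
    (Relation.join_le hRS ((Relation.comp_mono hSstr le_rfl).trans hSR))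
  obtain ⟨h, h₁, h₂⟩ := hHS
  -- as `H` is reflexive, `B̄(H, H) ≤ B̄((X, X), H)`
  obtain ⟨t, t₁, t₂⟩ := L.rel_le_rel hHrefl (le_refl H)
  have e₁ : (h ≫ s ≫ t) ≫ (L.rel (Relation.idRel M.a) H).outl = H.outl ≫ γ := by
    rw [Category.assoc, Category.assoc, t₁, s₁, reassoc_of% h₁]
  have e₂ : (h ≫ s ≫ t) ≫ (L.rel (Relation.idRel M.a) H).outr = H.outr ≫ γ' := by
    rw [Category.assoc, Category.assoc, t₂, s₂, reassoc_of% h₂]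
  exact ⟨h ≫ s ≫ t, e₁, e₂⟩
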